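/- Let $\mathcal A=(\mathcal P,\mathcal L)$ be a Desargues affine plane: any two different points lie on exactly one line; through a point off a line $\ell$ there is exactly one line disjoint from $\ell$; there are three non-collinear points; and Desargues' axiom holds (if $AA'$, $BB'$, $CC'$ are three different lines that are parallel or pass through one point, and $AB\parallel A'B'$, $BC\parallel B'C'$, then $AC\parallel A'C'$). A translation is a collineation $\varphi$ that maps each line to a parallel line and is either the identity or has no fixed point. Let $O\neq I$ be points and $\ell^{OI}$ the line through them, with the usual addition and multiplication of points, which have zero $O$ and unit $I$: choose a point $B_1\notin\ell^{OI}$ (the results do not depend on the choice). * Addition: let $P_1$ be the intersection of the parallel to $\ell^{OI}$ through $B_1$ with the parallel to $OB_1$ through $A$; then $A+B$ is the intersection of $\ell^{OI}$ with the parallel to $BB_1$ through $P_1$. * Multiplication: let $P_1$ be the intersection of $OB_1$ with the parallel to $IB_1$ through $A$; then $A\cdot B$ is the intersection of $\ell^{OI}$ with the parallel to $BB_1$ through $P_1$. For $A,B,C\in\ell^{OI}$ with $B\ne C$, the ratio $r(A,B;C)$ is the unique point $R\in\ell^{OI}$ with $(B-C)\cdot R=A-C$, that is, $R=(B-C)^{-1}(A-C)$.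 **Theorem.** Let $\varphi$ be a translation of a Desargues affine plane, let $O\ne I$, and let $A,B,C\in\ell^{OI}$ with $B\neq C$. Then $$\varphi\bigl(r(A,B;C)\bigr)=r\bigl(\varphi(A),\varphi(B);\varphi(C)\bigr),$$ where the ratio on the left is taken on $\ell^{OI}$ with zero $O$ and unit $I$, and the ratio on the right is taken on $\varphi(\ell^{OI})=\ell^{\varphi(O)\varphi(I)}$ with zero $\varphi(O)$ and unit $\varphi(I)$. This holds both when $\varphi(\ell^{OI})$ is a different line parallel to $\ell^{OI}$ and when $\varphi(\ell^{OI})=\ell^{OI}$. -/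

import Mathlib

/-- An affine plane on a set `P` of points. Lines are sets of points. -/
structure AffinePlane (P : Type*) where
  /-- the set of lines -/
  lines : Set (Set P)
  /-- two different points lie on exactly one line -/
  existsUnique_line : ∀ p q : P, p ≠ q → ∃! l : Set P, l ∈ lines ∧ p ∈ l ∧ q ∈ l
  /-- Playfair: through a point off a line there is exactly one line missing that line -/
  playfair : ∀ l ∈ lines, ∀ p : P, p ∉ l → ∃! m : Set P, m ∈ lines ∧ p ∈ m ∧ l ∩ m = ∅
  /-- there are three different points that do not lie on one line -/
  exists_triangle : ∃ p q r : P, p ≠ q ∧ p ≠ r ∧ q ≠ r ∧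
    ∀ l ∈ lines, ¬ (p ∈ l ∧ q ∈ l ∧ r ∈ l)

namespace AffinePlane

/-- Parallelism of lines: equal or disjoint. -/
def Parallel {P : Type*} (l m : Set P) : Prop := l = m ∨ l ∩ m = ∅

/-- The line through `p` and `q` (for `p ≠ q` there is exactly one, see `line_eq`). -/
def line {P : Type*} (𝒜 : AffinePlane P) (p q : P) : Set P :=
  {x | ∃ l ∈ 𝒜.lines, p ∈ l ∧ q ∈ l ∧ x ∈ l}

/-- The line through `p` parallel to the line `l` (there is exactly one, see `par_eq`). -/
def par {P : Type*} (𝒜 : AffinePlane P) (l : Set P) (p : P) : Set P :=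
  {x | ∃ m ∈ 𝒜.lines, p ∈ m ∧ Parallel l m ∧ x ∈ m}

/-- Desargues' axiom: let `AA'`, `BB'`, `CC'` be three different lines that are parallel or pass
through one point. If `AB ∥ A'B'` and `BC ∥ B'C'`, then `AC ∥ A'C'`. -/
def Desargues {P : Type*} (𝒜 : AffinePlane P) : Prop :=
  ∀ A B C A' B' C' : P,
    A ≠ A' → B ≠ B' → C ≠ C' →
    A ≠ B → A' ≠ B' → B ≠ C → B' ≠ C' → A ≠ C → A' ≠ C' →
    𝒜.line A A' ≠ 𝒜.line B B' → 𝒜.line B B' ≠ 𝒜.line C C' → 𝒜.line A A' ≠ 𝒜.line C C' →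
    ((Parallel (𝒜.line A A') (𝒜.line B B') ∧ Parallel (𝒜.line B B') (𝒜.line C C')) ∨
      ∃ V : P, V ∈ 𝒜.line A A' ∧ V ∈ 𝒜.line B B' ∧ V ∈ 𝒜.line C C') →
    Parallel (𝒜.line A B) (𝒜.line A' B') →
    Parallel (𝒜.line B C) (𝒜.line B' C') →
    Parallel (𝒜.line A C) (𝒜.line A' C')

/-- A collineation: a bijection of the points that induces a bijection of the lines. -/
def IsCollineation {P : Type*} (𝒜 : AffinePlane P) (φ : Equiv.Perm P) : Prop :=
  ∀ l : Set P, l ∈ 𝒜.lines ↔ φ '' l ∈ 𝒜.lines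

/-- A dilatation: a collineation that maps each line to a parallel line. -/
def IsDilatation {P : Type*} (𝒜 : AffinePlane P) (φ : Equiv.Perm P) : Prop :=
  𝒜.IsCollineation φ ∧ ∀ p q : P, p ≠ q → Parallel (φ '' 𝒜.line p q) (𝒜.line p q)

/-- A translation: the identity, or a dilatation without fixed points. -/
def IsTranslation {P : Type*} (𝒜 : AffinePlane P) (φ : Equiv.Perm P) : Prop :=
  𝒜.IsDilatation φ ∧ (φ = 1 ∨ ∀ p : P, φ p ≠ p)

theorem nonempty {P : Type*} (𝒜 : AffinePlane P) : Nonempty P :=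
  ⟨𝒜.exists_triangle.choose⟩

/-- The common point of two non-parallel lines (see `meet_eq`). -/
noncomputable def meet {P : Type*} (𝒜 : AffinePlane P) (l m : Set P) : P :=
  @Classical.epsilon P 𝒜.nonempty (fun p => p ∈ l ∧ p ∈ m)

/-- An auxiliary point outside the line `OI` (see `aux_notMem`). -/
noncomputable def aux {P : Type*} (𝒜 : AffinePlane P) (O I : P) : P :=
  @Classical.epsilon P 𝒜.nonempty (fun p => p ∉ 𝒜.line O I)

/-- Addition of points on the line `OI`. Choose `B₁` outside `OI`; let `P₁` be the intersection of
the parallel to `OI` through `B₁` with the parallel to `OB₁` through `A`; then `A + B` is the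
intersection of the parallel to `BB₁` through `P₁` with `OI`. -/
noncomputable def add {P : Type*} (𝒜 : AffinePlane P) (O I A B : P) : P :=
  let B₁ := 𝒜.aux O I
  let P₁ := 𝒜.meet (𝒜.par (𝒜.line O I) B₁) (𝒜.par (𝒜.line O B₁) A)
  𝒜.meet (𝒜.par (𝒜.line B B₁) P₁) (𝒜.line O I)

/-- Multiplication of points on the line `OI`. Choose `B₁` outside `OI`; let `P₁` be the
intersection of the parallel to `IB₁` through `A` with `OB₁`; then `A · B` is the intersection of
the parallel to `BB₁` through `P₁` with `OI`. -/
noncomputable def mul {P : Type*} (𝒜 : AffinePlane P) (O I A B : P) : P :=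
  let B₁ := 𝒜.aux O I
  let P₁ := 𝒜.meet (𝒜.par (𝒜.line I B₁) A) (𝒜.line O B₁)
  𝒜.meet (𝒜.par (𝒜.line B B₁) P₁) (𝒜.line O I)

/-- The point `-C` of the line `OI`: the solution `X` of `C + X = O`
(see `existsUnique_add_eq`). -/
noncomputable def neg {P : Type*} (𝒜 : AffinePlane P) (O I C : P) : P :=
  @Classical.epsilon P 𝒜.nonempty (fun X => X ∈ 𝒜.line O I ∧ 𝒜.add O I C X = O)

/-- The point `A - C = A + (-C)` of the line `OI`. -/
noncomputable def sub {P : Type*} (𝒜 : AffinePlane P) (O I A C : P) : P :=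
  𝒜.add O I A (𝒜.neg O I C)

/-- The ratio `r(A, B; C)` of three points `A, B, C` of the line `OI`, where `B ≠ C`: the point `R`
of this line with `(B - C) · R = A - C` (see `existsUnique_ratio`). -/
noncomputable def ratio {P : Type*} (𝒜 : AffinePlane P) (O I A B C : P) : P :=
  @Classical.epsilon P 𝒜.nonempty
    (fun R => R ∈ 𝒜.line O I ∧ 𝒜.mul O I (𝒜.sub O I B C) R = 𝒜.sub O I A C)

/-! The rest of this section proves that the objects chosen above exist and are unique. -/

section WellDefined

variable {P : Type*} (𝒜 : AffinePlane P)

theorem line_eq {l : Set P} {p q : P} (h : p ≠ q) (hl : l ∈ 𝒜.lines) (hp : p ∈ l) (hq : q ∈ l) :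
    𝒜.line p q = l := by
  ext x
  constructor
  · rintro ⟨m, hm, hpm, hqm, hx⟩
    rwa [(𝒜.existsUnique_line p q h).unique ⟨hl, hp, hq⟩ ⟨hm, hpm, hqm⟩]
  · exact fun hx => ⟨l, hl, hp, hq, hx⟩

theorem line_mem {p q : P} (h : p ≠ q) :
    𝒜.line p q ∈ 𝒜.lines ∧ p ∈ 𝒜.line p q ∧ q ∈ 𝒜.line p q := by
  obtain ⟨l, ⟨hl, hp, hq⟩, -⟩ := 𝒜.existsUnique_line p q h
  rw [𝒜.line_eq h hl hp hq]
  exact ⟨hl, hp, hq⟩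

theorem Parallel.symm {l m : Set P} (h : Parallel l m) : Parallel m l := by
  rcases h with h | h
  · exact Or.inl h.symm
  · exact Or.inr (by rwa [Set.inter_comm])

theorem Parallel.eq {l m : Set P} (h : Parallel l m) {x : P} (hl : x ∈ l) (hm : x ∈ m) :
    l = m := by
  rcases h with h | h
  · exact h
  · have : x ∈ l ∩ m := ⟨hl, hm⟩
    rw [h] at this
    exact this.elim

theorem existsUnique_par {l : Set P} (hl : l ∈ 𝒜.lines) (p : P) :
    ∃! m : Set P, m ∈ 𝒜.lines ∧ p ∈ m ∧ Parallel l m := by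
  by_cases hp : p ∈ l
  · exact ⟨l, ⟨hl, hp, Or.inl rfl⟩, fun m ⟨_, hpm, hm⟩ => (hm.eq hp hpm).symm⟩
  · obtain ⟨m, ⟨hm, hpm, hd⟩, hu⟩ := 𝒜.playfair l hl p hp
    refine ⟨m, ⟨hm, hpm, Or.inr hd⟩, fun n ⟨hn, hpn, h⟩ => hu n ⟨hn, hpn, ?_⟩⟩
    rcases h with h | h
    · subst h
      exact (hp hpn).elim
    · exact h

theorem par_eq {l m : Set P} {p : P} (hl : l ∈ 𝒜.lines) (hm : m ∈ 𝒜.lines) (hp : p ∈ m)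
    (h : Parallel l m) : 𝒜.par l p = m := by
  ext x
  constructor
  · rintro ⟨n, hn, hpn, h', hx⟩
    rwa [(𝒜.existsUnique_par hl p).unique ⟨hm, hp, h⟩ ⟨hn, hpn, h'⟩]
  · exact fun hx => ⟨m, hm, hp, h, hx⟩

theorem par_mem {l : Set P} (hl : l ∈ 𝒜.lines) (p : P) :
    𝒜.par l p ∈ 𝒜.lines ∧ p ∈ 𝒜.par l p ∧ Parallel l (𝒜.par l p) := by
  obtain ⟨m, ⟨hm, hp, h⟩, -⟩ := 𝒜.existsUnique_par hl p
  rw [𝒜.par_eq hl hm hp h]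
  exact ⟨hm, hp, h⟩

theorem Parallel.trans {l m n : Set P} (hl : l ∈ 𝒜.lines) (hm : m ∈ 𝒜.lines) (hn : n ∈ 𝒜.lines)
    (h : Parallel l m) (h' : Parallel m n) : Parallel l n := by
  by_cases hx : ∃ x, x ∈ l ∧ x ∈ n
  · obtain ⟨x, hxl, hxn⟩ := hx
    exact Or.inl ((𝒜.existsUnique_par hm x).unique ⟨hl, hxl, h.symm⟩ ⟨hn, hxn, h'⟩)
  · refine Or.inr (Set.eq_empty_of_forall_notMem fun x hx' => hx ⟨x, hx'.1, hx'.2⟩)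

theorem meet_mem {l m : Set P} (h : ¬ Parallel l m) : 𝒜.meet l m ∈ l ∧ 𝒜.meet l m ∈ m := by
  have hx : ∃ x, x ∈ l ∧ x ∈ m := by
    by_contra hx
    exact h (Or.inr (Set.eq_empty_of_forall_notMem fun x hx' => hx ⟨x, hx'.1, hx'.2⟩))
  exact @Classical.epsilon_spec_aux P 𝒜.nonempty (fun p => p ∈ l ∧ p ∈ m) hx

theorem meet_eq {l m : Set P} (hl : l ∈ 𝒜.lines) (hm : m ∈ 𝒜.lines) (h : ¬ Parallel l m) {x : P}
    (hxl : x ∈ l) (hxm : x ∈ m) : 𝒜.meet l m = x := by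
  by_contra hne
  obtain ⟨h1, h2⟩ := 𝒜.meet_mem h
  exact h (Or.inl ((𝒜.line_eq hne hl h1 hxl).symm.trans (𝒜.line_eq hne hm h2 hxm)))

theorem aux_notMem {O I : P} (h : O ≠ I) : 𝒜.aux O I ∉ 𝒜.line O I := by
  have hx : ∃ x, x ∉ 𝒜.line O I := by
    obtain ⟨p, q, r, -, -, -, ht⟩ := 𝒜.exists_triangle
    by_contra hx
    push Not at hx
    exact ht _ (𝒜.line_mem h).1 ⟨hx p, hx q, hx r⟩
  exact @Classical.epsilon_spec_aux P 𝒜.nonempty (fun p => p ∉ 𝒜.line O I) hx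

theorem not_parallel {l m : Set P} {x y : P} (hx : x ∈ l) (hxm : x ∈ m) (hy : y ∈ m)
    (hyl : y ∉ l) : ¬ Parallel m l := fun h => hyl (h.eq hxm hx ▸ hy)

/-- The last step of both algorithms. -/
theorem existsUnique_last {l : Set P} (hl : l ∈ 𝒜.lines) {B₁ P₁ : P} (hB : B₁ ∉ l) (hP : P₁ ∉ l) :
    (∀ X ∈ l, 𝒜.meet (𝒜.par (𝒜.line X B₁) P₁) l ∈ l) ∧
    ∀ S ∈ l, ∃! X, X ∈ l ∧ 𝒜.meet (𝒜.par (𝒜.line X B₁) P₁) l = S := by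
  have key : ∀ X ∈ l, 𝒜.line X B₁ ∈ 𝒜.lines ∧ ¬ Parallel (𝒜.par (𝒜.line X B₁) P₁) l := by
    intro X hX
    have hne : X ≠ B₁ := fun h => hB (h ▸ hX)
    obtain ⟨h1, h2, h3⟩ := 𝒜.line_mem hne
    obtain ⟨h4, h5, h6⟩ := 𝒜.par_mem h1 P₁
    exact ⟨h1, fun h => not_parallel hX h2 h3 hB (h6.trans 𝒜 h1 h4 hl h)⟩
  refine ⟨fun X hX => (𝒜.meet_mem (key X hX).2).2, fun S hS => ?_⟩
  have hSP : S ≠ P₁ := fun h => hP (h ▸ hS)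
  obtain ⟨g1, g2, g3⟩ := 𝒜.line_mem hSP
  obtain ⟨g4, g5, g6⟩ := 𝒜.par_mem g1 B₁
  have hn : ¬ Parallel (𝒜.par (𝒜.line S P₁) B₁) l :=
    fun h => not_parallel hS g2 g3 hP (g6.trans 𝒜 g1 g4 hl h)
  obtain ⟨hX1, hX2⟩ := 𝒜.meet_mem hn
  refine ⟨𝒜.meet (𝒜.par (𝒜.line S P₁) B₁) l, ⟨hX2, ?_⟩, ?_⟩
  · set X := 𝒜.meet (𝒜.par (𝒜.line S P₁) B₁) l
    have hne : X ≠ B₁ := fun h => hB (h ▸ hX2)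
    have e1 : 𝒜.line X B₁ = 𝒜.par (𝒜.line S P₁) B₁ := 𝒜.line_eq hne g4 hX1 g5
    have e2 : 𝒜.par (𝒜.line X B₁) P₁ = 𝒜.line S P₁ := by
      rw [e1]
      exact 𝒜.par_eq g4 g1 g3 g6.symm
    rw [e2]
    exact 𝒜.meet_eq g1 hl (not_parallel hS g2 g3 hP) g2 hS
  · rintro Y ⟨hY, hYS⟩
    obtain ⟨k1, k2⟩ := key Y hY
    have hne : Y ≠ B₁ := fun h => hB (h ▸ hY)
    obtain ⟨-, k3, k4⟩ := 𝒜.line_mem hne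
    obtain ⟨k5, k6, k7⟩ := 𝒜.par_mem k1 P₁
    have hSm := (𝒜.meet_mem k2).1
    rw [hYS] at hSm
    have e1 : 𝒜.line S P₁ = 𝒜.par (𝒜.line Y B₁) P₁ := 𝒜.line_eq hSP k5 hSm k6
    have e2 : 𝒜.par (𝒜.line S P₁) B₁ = 𝒜.line Y B₁ := by
      rw [e1]
      exact 𝒜.par_eq k5 k1 k4 k7.symm
    rw [e2]
    exact (𝒜.meet_eq k1 hl (not_parallel hY k3 k4 hB) k3 hY).symm

/-- The first step of the addition. -/
theorem add_first {O I : P} (h : O ≠ I) (A : P) :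
    𝒜.par (𝒜.line O I) (𝒜.aux O I) ∈ 𝒜.lines ∧
    𝒜.par (𝒜.line O (𝒜.aux O I)) A ∈ 𝒜.lines ∧
    𝒜.line O (𝒜.aux O I) ∈ 𝒜.lines ∧
    ¬ Parallel (𝒜.line O (𝒜.aux O I)) (𝒜.line O I) ∧
    ¬ Parallel (𝒜.par (𝒜.line O I) (𝒜.aux O I)) (𝒜.par (𝒜.line O (𝒜.aux O I)) A) ∧
    𝒜.meet (𝒜.par (𝒜.line O I) (𝒜.aux O I)) (𝒜.par (𝒜.line O (𝒜.aux O I)) A) ∉ 𝒜.line O I := by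
  have hB := 𝒜.aux_notMem h
  obtain ⟨h1, h2, -⟩ := 𝒜.line_mem h
  have hne : O ≠ 𝒜.aux O I := fun e => hB (e ▸ h2)
  obtain ⟨g1, g2, g3⟩ := 𝒜.line_mem hne
  obtain ⟨p1, p2, p3⟩ := 𝒜.par_mem h1 (𝒜.aux O I)
  obtain ⟨q1, q2, q3⟩ := 𝒜.par_mem g1 A
  have n1 : ¬ Parallel (𝒜.line O (𝒜.aux O I)) (𝒜.line O I) := not_parallel h2 g2 g3 hB
  have n2 : ¬ Parallel (𝒜.par (𝒜.line O I) (𝒜.aux O I)) (𝒜.par (𝒜.line O (𝒜.aux O I)) A) :=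
    fun e => n1 ((p3.trans 𝒜 h1 p1 q1 e).trans 𝒜 h1 q1 g1 q3.symm).symm
  refine ⟨p1, q1, g1, n1, n2, fun hm => hB ?_⟩
  rw [p3.eq hm (𝒜.meet_mem n2).1]
  exact p2

theorem add_mem {O I A B : P} (h : O ≠ I) (hB : B ∈ 𝒜.line O I) :
    𝒜.add O I A B ∈ 𝒜.line O I :=
  (𝒜.existsUnique_last (𝒜.line_mem h).1 (𝒜.aux_notMem h) (𝒜.add_first h A).2.2.2.2.2).1 B hB

theorem existsUnique_add_eq {O I A S : P} (h : O ≠ I) (hS : S ∈ 𝒜.line O I) :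
    ∃! X, X ∈ 𝒜.line O I ∧ 𝒜.add O I A X = S :=
  (𝒜.existsUnique_last (𝒜.line_mem h).1 (𝒜.aux_notMem h) (𝒜.add_first h A).2.2.2.2.2).2 S hS

theorem neg_spec {O I : P} (C : P) (h : O ≠ I) :
    𝒜.neg O I C ∈ 𝒜.line O I ∧ 𝒜.add O I C (𝒜.neg O I C) = O :=
  @Classical.epsilon_spec_aux P 𝒜.nonempty
    (fun X => X ∈ 𝒜.line O I ∧ 𝒜.add O I C X = O)
    (𝒜.existsUnique_add_eq h (𝒜.line_mem h).2.1).exists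

theorem sub_mem {O I A C : P} (h : O ≠ I) : 𝒜.sub O I A C ∈ 𝒜.line O I :=
  𝒜.add_mem h (𝒜.neg_spec C h).1

theorem add_right_cancel {O I A B X : P} (h : O ≠ I) (hA : A ∈ 𝒜.line O I) (hB : B ∈ 𝒜.line O I)
    (hX : X ∈ 𝒜.line O I) (e : 𝒜.add O I A X = 𝒜.add O I B X) : A = B := by
  obtain ⟨h1, -, -⟩ := 𝒜.line_mem h
  have hB₁ := 𝒜.aux_notMem h
  obtain ⟨a1, a2, a3, a4, a5, a6⟩ := 𝒜.add_first h A
  obtain ⟨-, b2, -, -, b5, b6⟩ := 𝒜.add_first h B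
  have hne : X ≠ 𝒜.aux O I := fun e => hB₁ (e ▸ hX)
  obtain ⟨g1, g2, g3⟩ := 𝒜.line_mem hne
  have n1 : ¬ Parallel (𝒜.line X (𝒜.aux O I)) (𝒜.line O I) := not_parallel hX g2 g3 hB₁
  unfold add at e
  dsimp only at e
  set k := 𝒜.par (𝒜.line O I) (𝒜.aux O I)
  set PA := 𝒜.meet k (𝒜.par (𝒜.line O (𝒜.aux O I)) A)
  set PB := 𝒜.meet k (𝒜.par (𝒜.line O (𝒜.aux O I)) B)
  have hk : Parallel (𝒜.line O I) k := (𝒜.par_mem h1 _).2.2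
  obtain ⟨p1, p2, p3⟩ := 𝒜.par_mem g1 PA
  obtain ⟨q1, q2, q3⟩ := 𝒜.par_mem g1 PB
  have np : ¬ Parallel (𝒜.par (𝒜.line X (𝒜.aux O I)) PA) (𝒜.line O I) :=
    fun e => n1 (p3.trans 𝒜 g1 p1 h1 e)
  have nq : ¬ Parallel (𝒜.par (𝒜.line X (𝒜.aux O I)) PB) (𝒜.line O I) :=
    fun e => n1 (q3.trans 𝒜 g1 q1 h1 e)
  have s1 := (𝒜.meet_mem np).1
  have s2 := (𝒜.meet_mem nq).1
  rw [e] at s1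
  have e1 := (p3.symm.trans 𝒜 p1 g1 q1 q3).eq s1 s2
  have hPA : PA ∈ k ∧ PA ∈ 𝒜.par (𝒜.line O (𝒜.aux O I)) A := 𝒜.meet_mem a5
  have hPB : PB ∈ k ∧ PB ∈ 𝒜.par (𝒜.line O (𝒜.aux O I)) B := 𝒜.meet_mem b5
  have ePP : PA = PB := by
    by_contra hPP
    rw [e1] at p2
    have e3 := (𝒜.line_eq hPP a1 hPA.1 hPB.1).symm.trans (𝒜.line_eq hPP q1 p2 q2)
    exact nq (e3 ▸ hk.symm)
  obtain ⟨-, u2, u3⟩ := 𝒜.par_mem a3 A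
  obtain ⟨-, v2, v3⟩ := 𝒜.par_mem a3 B
  have e4 := (u3.symm.trans 𝒜 a2 a3 b2 v3).eq hPA.2 (ePP ▸ hPB.2)
  by_contra hAB
  rw [e4] at u2
  have e5 := (𝒜.line_eq hAB h1 hA hB).symm.trans (𝒜.line_eq hAB b2 u2 v2)
  exact a4 (e5 ▸ v3)

theorem sub_ne {O I B C : P} (h : O ≠ I) (hB : B ∈ 𝒜.line O I) (hC : C ∈ 𝒜.line O I)
    (hBC : B ≠ C) : 𝒜.sub O I B C ≠ O := by
  intro e
  obtain ⟨h1, h2⟩ := 𝒜.neg_spec C h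
  exact hBC (𝒜.add_right_cancel h hB hC h1 (e.trans h2.symm))

theorem existsUnique_mul_eq {O I M S : P} (h : O ≠ I) (hM : M ∈ 𝒜.line O I) (hMO : M ≠ O)
    (hS : S ∈ 𝒜.line O I) : ∃! X, X ∈ 𝒜.line O I ∧ 𝒜.mul O I M X = S := by
  obtain ⟨h1, h2, h3⟩ := 𝒜.line_mem h
  have hB := 𝒜.aux_notMem h
  have hO : O ≠ 𝒜.aux O I := fun e => hB (e ▸ h2)
  have hI : I ≠ 𝒜.aux O I := fun e => hB (e ▸ h3)
  obtain ⟨o1, o2, o3⟩ := 𝒜.line_mem hO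
  obtain ⟨i1, i2, i3⟩ := 𝒜.line_mem hI
  obtain ⟨p1, p2, p3⟩ := 𝒜.par_mem i1 M
  have hOn : O ∉ 𝒜.line I (𝒜.aux O I) := fun hm =>
    hB (by rw [𝒜.line_eq h i1 hm i2]; exact i3)
  have n1 : ¬ Parallel (𝒜.par (𝒜.line I (𝒜.aux O I)) M) (𝒜.line O (𝒜.aux O I)) := fun e =>
    not_parallel i3 o3 o2 hOn (p3.trans 𝒜 i1 p1 o1 e).symm
  have hm := 𝒜.meet_mem n1
  refine (𝒜.existsUnique_last h1 hB (fun hl => ?_)).2 S hS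
  set Q := 𝒜.meet (𝒜.par (𝒜.line I (𝒜.aux O I)) M) (𝒜.line O (𝒜.aux O I))
  have hQO : Q = O := by
    by_contra hne
    have e := (𝒜.line_eq hne h1 hl h2).symm.trans (𝒜.line_eq hne o1 hm.2 o2)
    exact hB (e ▸ o3)
  rw [hQO] at hm
  have e := (𝒜.line_eq hMO h1 hM h2).symm.trans (𝒜.line_eq hMO p1 p2 hm.1)
  exact not_parallel h3 i2 i3 hB (e ▸ p3)

theorem existsUnique_ratio {O I A B C : P} (h : O ≠ I) (hB : B ∈ 𝒜.line O I)
    (hC : C ∈ 𝒜.line O I) (hBC : B ≠ C) :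
    ∃! R, R ∈ 𝒜.line O I ∧ 𝒜.mul O I (𝒜.sub O I B C) R = 𝒜.sub O I A C :=
  𝒜.existsUnique_mul_eq h (𝒜.sub_mem h) (𝒜.sub_ne h hB hC hBC) (𝒜.sub_mem h)

theorem ratio_spec {O I A B C : P} (h : O ≠ I) (hB : B ∈ 𝒜.line O I)
    (hC : C ∈ 𝒜.line O I) (hBC : B ≠ C) :
    𝒜.ratio O I A B C ∈ 𝒜.line O I ∧
      𝒜.mul O I (𝒜.sub O I B C) (𝒜.ratio O I A B C) = 𝒜.sub O I A C :=
  @Classical.epsilon_spec_aux P 𝒜.nonempty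
    (fun R => R ∈ 𝒜.line O I ∧ 𝒜.mul O I (𝒜.sub O I B C) R = 𝒜.sub O I A C)
    (𝒜.existsUnique_ratio h hB hC hBC).exists

end WellDefined

end AffinePlane

/-!
The sum and the product of points on `OI` are constructed from an auxiliary point off the line. Any
collineation carries the construction for `O`, `I` and auxiliary point `B₁` to the construction for
`φ O`, `φ I` and auxiliary point `φ B₁`. The auxiliary point chosen on the image line need not be
`φ B₁`, so the content of the theorem is that sum and product do not depend on the auxiliary point
(`IsSum.change_aux`, `IsProd.change_aux`); this is where Desargues' axiom enters. Differences and
ratios are unique solutions of equations in sums and products, hence are preserved as well. Of `φ`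
only the collineation property matters.

For two auxiliary points `B₁`, `B₂` in general position, two applications of Desargues' axiom (with
parallel axes for the sum, with axes through `O` for the product) give the independence: the first
shows that the line of the two intermediate points is parallel to `B₁B₂`, the second that both
constructions end in the same point. In special position one passes through a third auxiliary point.
For the product it always exists. For the sum it has to avoid `OI` and the parallel to `OI` through
`B₁`, which is possible as soon as the line `OI` has a third point; on a line with the two points
`O` and `I` the sum is computed directly.
-/

namespace AffinePlane

variable {P : Type*} {𝒜 : AffinePlane P}

/-! ### Incidence and parallels -/

theorem eq_of_mem_of_mem {l m : Set P} (hl : l ∈ 𝒜.lines) (hm : m ∈ 𝒜.lines) (h : l ≠ m)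
    {x y : P} (hxl : x ∈ l) (hxm : x ∈ m) (hyl : y ∈ l) (hym : y ∈ m) : x = y := by
  by_contra hne
  exact h ((𝒜.line_eq hne hl hxl hyl).symm.trans (𝒜.line_eq hne hm hxm hym))

theorem line_comm (p q : P) : 𝒜.line p q = 𝒜.line q p := by
  ext x
  constructor <;> rintro ⟨l, hl, h1, h2, h3⟩ <;> exact ⟨l, hl, h2, h1, h3⟩

theorem par_of_mem {l : Set P} (hl : l ∈ 𝒜.lines) {p : P} (hp : p ∈ l) : 𝒜.par l p = l :=
  𝒜.par_eq hl hl hp (Or.inl rfl)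

theorem par_eq_of_mem {l : Set P} (hl : l ∈ 𝒜.lines) {p x : P} (hx : x ∈ 𝒜.par l p) :
    𝒜.par l x = 𝒜.par l p :=
  𝒜.par_eq hl (𝒜.par_mem hl p).1 hx (𝒜.par_mem hl p).2.2

theorem mem_par_symm {l : Set P} (hl : l ∈ 𝒜.lines) {p x : P} (hx : x ∈ 𝒜.par l p) :
    p ∈ 𝒜.par l x :=
  par_eq_of_mem hl hx ▸ (𝒜.par_mem hl p).2.1

theorem notMem_par {l : Set P} (hl : l ∈ 𝒜.lines) {p x : P} (hp : p ∉ l) (hx : x ∈ l) :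
    x ∉ 𝒜.par l p := fun h => hp (par_of_mem hl hx ▸ mem_par_symm hl h)

theorem line_parallel_iff {l : Set P} (hl : l ∈ 𝒜.lines) {p q : P} (h : p ≠ q) :
    Parallel l (𝒜.line p q) ↔ q ∈ 𝒜.par l p := by
  obtain ⟨h1, h2, h3⟩ := 𝒜.line_mem h
  obtain ⟨g1, g2, g3⟩ := 𝒜.par_mem hl p
  refine ⟨fun e => by rwa [𝒜.par_eq hl h1 h2 e], fun e => ?_⟩
  rwa [𝒜.line_eq h g1 g2 e]

theorem parallel_of_mem_par {l m : Set P} (hl : l ∈ 𝒜.lines) (hm : m ∈ 𝒜.lines) {p q : P}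
    (h : p ≠ q) (hp : p ∈ m) (hq : q ∈ m) (hpq : q ∈ 𝒜.par l p) : Parallel l m := by
  rw [← 𝒜.line_eq h hm hp hq]
  exact (line_parallel_iff hl h).2 hpq

theorem exists_mem_par_par {l m : Set P} (hl : l ∈ 𝒜.lines) (hm : m ∈ 𝒜.lines)
    (h : ¬ Parallel l m) (p q : P) : ∃ x, x ∈ 𝒜.par l p ∧ x ∈ 𝒜.par m q := by
  obtain ⟨h1, -, h3⟩ := 𝒜.par_mem hl p
  obtain ⟨g1, -, g3⟩ := 𝒜.par_mem hm q
  exact ⟨_, 𝒜.meet_mem fun e => h ((h3.trans 𝒜 hl h1 g1 e).trans 𝒜 hl g1 hm g3.symm)⟩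

/-- Facts about the line joining a point of `l` to a point off `l`. -/
theorem transversal {l : Set P} {p q : P} (hp : p ∈ l) (hq : q ∉ l) :
    p ≠ q ∧ 𝒜.line p q ∈ 𝒜.lines ∧ p ∈ 𝒜.line p q ∧ q ∈ 𝒜.line p q ∧
      ¬ Parallel l (𝒜.line p q) := by
  have hne : p ≠ q := fun h => hq (h ▸ hp)
  obtain ⟨h1, h2, h3⟩ := 𝒜.line_mem hne
  exact ⟨hne, h1, h2, h3, fun h => not_parallel hp h2 h3 hq h.symm⟩

/-- The lines joining `O` and `I` to a point off `OI` are not parallel. -/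
theorem not_parallel_line_line {O I B₁ : P} (h : O ≠ I) (hB₁ : B₁ ∉ 𝒜.line O I) :
    ¬ Parallel (𝒜.line I B₁) (𝒜.line O B₁) := by
  obtain ⟨h1, h2, h3⟩ := 𝒜.line_mem h
  obtain ⟨-, o1, o2, o3, o4⟩ := transversal h2 hB₁
  obtain ⟨-, i1, i2, i3, -⟩ := transversal h3 hB₁
  exact fun e => h (eq_of_mem_of_mem h1 o1 (fun k => o4 (Or.inl k)) h2 o2 h3 (e.eq i3 o3 ▸ i2))

/-! ### Desargues' axiom without degenerate cases -/

/-- Let `A ∉ b` and `B, B' ∈ b` with `A'B' ∥ AB`. If `A = A'`, then `B = B'`. -/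
theorem eq_of_collapse {b : Set P} (hb : b ∈ 𝒜.lines) {A B A' B' : P}
    (hB : B ∈ b) (hB' : B' ∈ b) (hAb : A ∉ b) (h : B' ∈ 𝒜.par (𝒜.line A B) A')
    (e : A = A') : B = B' := by
  obtain ⟨-, h1, h2, h3, -⟩ := transversal (𝒜 := 𝒜) hB hAb
  rw [line_comm] at h1 h2 h3
  rw [← e, par_of_mem h1 h3] at h
  exact eq_of_mem_of_mem h1 hb (fun e => hAb (e ▸ h3)) h2 hB h hB'

/-- Desargues' axiom with axes `a`, `b`, `c`, where corresponding points may coincide. -/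
theorem Desargues.mem_par (hD : 𝒜.Desargues) {a b c : Set P} (ha : a ∈ 𝒜.lines)
    (hb : b ∈ 𝒜.lines) (hc : c ∈ 𝒜.lines)
    (habc : (Parallel a b ∧ Parallel b c) ∨ ∃ V, V ∈ a ∧ V ∈ b ∧ V ∈ c)
    {A A' B B' C C' : P} (hA : A ∈ a) (hA' : A' ∈ a) (hB : B ∈ b) (hB' : B' ∈ b) (hC : C ∈ c)
    (hC' : C' ∈ c) (hAb : A ∉ b) (hAc : A ∉ c) (hBa : B ∉ a) (hBc : B ∉ c) (hCb : C ∉ b)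
    (hAB' : A' ≠ B') (hBC' : B' ≠ C') (hAC' : A' ≠ C')
    (h1 : B' ∈ 𝒜.par (𝒜.line A B) A') (h2 : C' ∈ 𝒜.par (𝒜.line B C) B') :
    C' ∈ 𝒜.par (𝒜.line A C) A' := by
  have hAB : A ≠ B := fun e => hAb (e ▸ hB)
  have hBC : B ≠ C := fun e => hBc (e ▸ hC)
  have hAC : A ≠ C := fun e => hAc (e ▸ hC)
  obtain ⟨l1, -, -⟩ := 𝒜.line_mem hAB
  obtain ⟨m1, -, -⟩ := 𝒜.line_mem hBC
  obtain ⟨n1, -, n3⟩ := 𝒜.line_mem hAC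
  by_cases hAA : A = A'
  · have e1 := eq_of_collapse hb hB hB' hAb h1 hAA
    have e2 := eq_of_collapse hc hC hC' hBc h2 e1
    rw [← hAA, ← e2]
    rwa [par_of_mem n1 (𝒜.line_mem hAC).2.1]
  have hBB : B ≠ B' := fun e => hAA <| eq_of_collapse ha hA hA' hBa
    (by rw [line_comm]; exact mem_par_symm l1 h1) e
  have hCC : C ≠ C' := fun e => hBB <| eq_of_collapse hb hB hB' hCb
    (by rw [line_comm]; exact mem_par_symm m1 h2) e
  have ea := 𝒜.line_eq hAA ha hA hA'
  have eb := 𝒜.line_eq hBB hb hB hB'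
  have ec := 𝒜.line_eq hCC hc hC hC'
  rw [← line_parallel_iff l1 hAB'] at h1
  rw [← line_parallel_iff m1 hBC'] at h2
  rw [← line_parallel_iff n1 hAC']
  rw [← ea, ← eb, ← ec] at habc
  refine hD A B C A' B' C' hAA hBB hCC hAB hAB' hBC hBC' hAC hAC'
    (fun e => hAb ?_) (fun e => hBc ?_) (fun e => hAc ?_) habc h1 h2
  · rwa [← eb, ← e, ea]
  · rwa [← ec, ← e, eb]
  · rwa [← ec, ← e, ea]

/-- Desargues' axiom with three different parallel axes. -/
theorem Desargues.mem_par_of_parallel (hD : 𝒜.Desargues) {a b c : Set P} (ha : a ∈ 𝒜.lines)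
    (hb : b ∈ 𝒜.lines) (hc : c ∈ 𝒜.lines) (hab : Parallel a b) (hbc : Parallel b c)
    (nab : a ≠ b) (nbc : b ≠ c) (nac : a ≠ c)
    {A A' B B' C C' : P} (hA : A ∈ a) (hA' : A' ∈ a) (hB : B ∈ b) (hB' : B' ∈ b) (hC : C ∈ c)
    (hC' : C' ∈ c) (h1 : B' ∈ 𝒜.par (𝒜.line A B) A') (h2 : C' ∈ 𝒜.par (𝒜.line B C) B') :
    C' ∈ 𝒜.par (𝒜.line A C) A' := by
  have hac := hab.trans 𝒜 ha hb hc hbc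
  refine hD.mem_par ha hb hc (Or.inl ⟨hab, hbc⟩) hA hA' hB hB' hC hC' (fun h => nab (hab.eq hA h))
    (fun h => nac (hac.eq hA h)) (fun h => nab (hab.eq h hB)) (fun h => nbc (hbc.eq hB h))
    (fun h => nbc (hbc.eq h hC)) ?_ ?_ ?_ h1 h2
  · exact fun h => nab (hab.eq hA' (h ▸ hB'))
  · exact fun h => nbc (hbc.eq hB' (h ▸ hC'))
  · exact fun h => nac (hac.eq hA' (h ▸ hC'))

/-- If `A'B' ∥ AB`, where `A`, `A'` and `B`, `B'` lie on two lines through `V`, then `A' = V` forces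
`B' = V`. -/
theorem eq_of_eq_center {b : Set P} (hb : b ∈ 𝒜.lines) {A B V B' : P} (hV : V ∈ b) (hB : B ∈ b)
    (hB' : B' ∈ b) (hAb : A ∉ b) (h : B' ∈ 𝒜.par (𝒜.line A B) V) : B' = V := by
  by_contra hne
  obtain ⟨-, h1, h2, h3, h4⟩ := transversal (𝒜 := 𝒜) hB hAb
  rw [line_comm] at h
  exact h4 (parallel_of_mem_par h1 hb (Ne.symm hne) hV hB' h).symm

/-- Desargues' axiom with three different axes through a point `V`. -/
theorem Desargues.mem_par_of_center (hD : 𝒜.Desargues) {a b c : Set P} (ha : a ∈ 𝒜.lines)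
    (hb : b ∈ 𝒜.lines) (hc : c ∈ 𝒜.lines) {V : P} (hVa : V ∈ a) (hVb : V ∈ b) (hVc : V ∈ c)
    (nab : a ≠ b) (nbc : b ≠ c) (nac : a ≠ c)
    {A A' B B' C C' : P} (hA : A ∈ a) (hA' : A' ∈ a) (hB : B ∈ b) (hB' : B' ∈ b) (hC : C ∈ c)
    (hC' : C' ∈ c) (nA : A ≠ V) (nB : B ≠ V) (nC : C ≠ V)
    (h1 : B' ∈ 𝒜.par (𝒜.line A B) A') (h2 : C' ∈ 𝒜.par (𝒜.line B C) B') :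
    C' ∈ 𝒜.par (𝒜.line A C) A' := by
  have hAb : A ∉ b := fun h => nA (eq_of_mem_of_mem ha hb nab hA h hVa hVb)
  have hAc : A ∉ c := fun h => nA (eq_of_mem_of_mem ha hc nac hA h hVa hVc)
  have hBa : B ∉ a := fun h => nB (eq_of_mem_of_mem ha hb nab h hB hVa hVb)
  have hBc : B ∉ c := fun h => nB (eq_of_mem_of_mem hb hc nbc hB h hVb hVc)
  have hCb : C ∉ b := fun h => nC (eq_of_mem_of_mem hb hc nbc h hC hVb hVc)
  have lAB := (transversal (𝒜 := 𝒜) hA (fun h => hBa h)).2.1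
  by_cases e : A' = V
  · subst e
    obtain rfl := eq_of_eq_center hb hVb hB hB' hAb h1
    obtain rfl := eq_of_eq_center hc hVc hC hC' hBc h2
    rw [line_comm]
    exact (𝒜.par_mem (transversal hC hAc).2.1 _).2.1
  have e' : B' ≠ V := by
    rintro rfl
    refine e (eq_of_eq_center ha hVa hA hA' hBa ?_)
    rw [line_comm]
    exact mem_par_symm lAB h1
  refine hD.mem_par ha hb hc (Or.inr ⟨V, hVa, hVb, hVc⟩) hA hA' hB hB' hC hC' hAb hAc hBa hBc hCb
    ?_ ?_ ?_ h1 h2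
  · exact fun h => e (eq_of_mem_of_mem ha hb nab hA' (h ▸ hB') hVa hVb)
  · exact fun h => e' (eq_of_mem_of_mem hb hc nbc hB' (h ▸ hC') hVb hVc)
  · exact fun h => e (eq_of_mem_of_mem ha hc nac hA' (h ▸ hC') hVa hVc)

/-! ### Sums with an arbitrary auxiliary point -/

/-- `S` is the sum `A + B` on the line `OI`, constructed with the auxiliary point `B₁`; the witness
is the intermediate point of the construction. -/
def IsSum (𝒜 : AffinePlane P) (O I B₁ A B S : P) : Prop :=
  ∃ Q, Q ∈ 𝒜.par (𝒜.line O I) B₁ ∧ Q ∈ 𝒜.par (𝒜.line O B₁) A ∧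
    S ∈ 𝒜.par (𝒜.line B B₁) Q ∧ S ∈ 𝒜.line O I

theorem isSum_add {O I A B : P} (h : O ≠ I) (hB : B ∈ 𝒜.line O I) :
    𝒜.IsSum O I (𝒜.aux O I) A B (𝒜.add O I A B) := by
  obtain ⟨h1, -, -⟩ := 𝒜.line_mem h
  obtain ⟨-, -, -, -, n, -⟩ := 𝒜.add_first h A
  obtain ⟨-, g1, -, -, g4⟩ := transversal hB (𝒜.aux_notMem h)
  obtain ⟨p1, -, p3⟩ := 𝒜.par_mem g1
    (𝒜.meet (𝒜.par (𝒜.line O I) (𝒜.aux O I)) (𝒜.par (𝒜.line O (𝒜.aux O I)) A))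
  exact ⟨_, (𝒜.meet_mem n).1, (𝒜.meet_mem n).2,
    𝒜.meet_mem fun e => g4 (p3.trans 𝒜 g1 p1 h1 e).symm⟩

theorem IsSum.add_eq {O I A B S : P} (h : O ≠ I) (hB : B ∈ 𝒜.line O I)
    (hS : 𝒜.IsSum O I (𝒜.aux O I) A B S) : 𝒜.add O I A B = S := by
  obtain ⟨h1, -, -⟩ := 𝒜.line_mem h
  obtain ⟨Q, hQ1, hQ2, hS1, hS2⟩ := hS
  obtain ⟨a1, a2, -, -, n, -⟩ := 𝒜.add_first h A
  obtain ⟨-, g1, -, -, g4⟩ := transversal hB (𝒜.aux_notMem h)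
  obtain ⟨p1, -, p3⟩ := 𝒜.par_mem g1 Q
  unfold add
  dsimp only
  rw [𝒜.meet_eq a1 a2 n hQ1 hQ2]
  exact 𝒜.meet_eq p1 h1 (fun e => g4 (p3.trans 𝒜 g1 p1 h1 e).symm) hS1 hS2

theorem exists_isSum {O I B₁ A B : P} (h : O ≠ I) (hB₁ : B₁ ∉ 𝒜.line O I)
    (hB : B ∈ 𝒜.line O I) : ∃ S, 𝒜.IsSum O I B₁ A B S := by
  obtain ⟨h1, h2, -⟩ := 𝒜.line_mem h
  obtain ⟨-, o1, -, -, o4⟩ := transversal h2 hB₁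
  obtain ⟨-, g1, -, -, g4⟩ := transversal hB hB₁
  obtain ⟨Q, hQ1, hQ2⟩ := exists_mem_par_par h1 o1 o4 B₁ A
  obtain ⟨S, hS1, hS2⟩ := exists_mem_par_par g1 h1 (fun e => g4 e.symm) Q O
  exact ⟨S, Q, hQ1, hQ2, hS1, par_of_mem h1 h2 ▸ hS2⟩

theorem IsSum.eq_of_zero_left {O I B₁ B S : P} (h : O ≠ I) (hB₁ : B₁ ∉ 𝒜.line O I)
    (hB : B ∈ 𝒜.line O I) (hS : 𝒜.IsSum O I B₁ O B S) : S = B := by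
  obtain ⟨h1, h2, -⟩ := 𝒜.line_mem h
  obtain ⟨Q, hQ1, hQ2, hS1, hS2⟩ := hS
  obtain ⟨-, o1, o2, o3, -⟩ := transversal h2 hB₁
  obtain ⟨-, g1, g2, g3, g4⟩ := transversal hB hB₁
  obtain ⟨p1, p2, p3⟩ := 𝒜.par_mem h1 B₁
  rw [par_of_mem o1 o2] at hQ2
  have e : 𝒜.par (𝒜.line O I) B₁ ≠ 𝒜.line O B₁ := fun e => by
    rw [← e] at o2
    exact hB₁ (p3.eq h2 o2 ▸ p2)
  obtain rfl : Q = B₁ := eq_of_mem_of_mem p1 o1 e hQ1 hQ2 p2 o3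
  rw [par_of_mem g1 g3] at hS1
  exact eq_of_mem_of_mem h1 g1 (fun e => g4 (Or.inl e)) hS2 hS1 hB g2

theorem IsSum.eq_of_zero_right {O I B₁ A S : P} (h : O ≠ I) (hB₁ : B₁ ∉ 𝒜.line O I)
    (hA : A ∈ 𝒜.line O I) (hS : 𝒜.IsSum O I B₁ A O S) : S = A := by
  obtain ⟨h1, h2, -⟩ := 𝒜.line_mem h
  obtain ⟨Q, hQ1, hQ2, hS1, hS2⟩ := hS
  obtain ⟨-, o1, o2, o3, o4⟩ := transversal h2 hB₁
  obtain ⟨p1, p2, p3⟩ := 𝒜.par_mem o1 A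
  rw [par_eq_of_mem o1 hQ2] at hS1
  exact eq_of_mem_of_mem h1 p1 (fun e => o4 (e ▸ p3.symm)) hS2 hS1 hA p2

/-- `I + I ≠ I`. -/
theorem IsSum.ne_of_one_one {O I B₁ S : P} (h : O ≠ I) (hB₁ : B₁ ∉ 𝒜.line O I)
    (hS : 𝒜.IsSum O I B₁ I I S) : S ≠ I := by
  rintro rfl
  obtain ⟨h1, h2, h3⟩ := 𝒜.line_mem h
  obtain ⟨Q, hQ1, hQ2, hS1, -⟩ := hS
  obtain ⟨-, o1, o2, o3, o4⟩ := transversal h2 hB₁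
  obtain ⟨-, g1, g2, g3, -⟩ := transversal h3 hB₁
  have hne : S ≠ Q := fun e => notMem_par h1 hB₁ h3 (e ▸ hQ1)
  have e1 := (line_parallel_iff o1 hne).2 hQ2
  have e2 := (line_parallel_iff g1 hne).2 (mem_par_symm g1 hS1)
  exact not_parallel_line_line h hB₁ (e2.trans 𝒜 g1 (𝒜.line_mem hne).1 o1 e1.symm)

/-- The sum does not depend on the auxiliary point if the two auxiliary points lie on different
parallels to `OI`. -/
theorem IsSum.change_aux_of_notMem (hD : 𝒜.Desargues) {O I B₁ B₂ A B S : P} (h : O ≠ I)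
    (hB₁ : B₁ ∉ 𝒜.line O I) (hB₂ : B₂ ∉ 𝒜.line O I) (h12 : B₂ ∉ 𝒜.par (𝒜.line O I) B₁)
    (hA : A ∈ 𝒜.line O I) (hB : B ∈ 𝒜.line O I) (hS : 𝒜.IsSum O I B₁ A B S) :
    𝒜.IsSum O I B₂ A B S := by
  obtain ⟨h1, h2, h3⟩ := 𝒜.line_mem h
  obtain ⟨Q, hQ1, hQ2, hS1, hS2⟩ := hS
  obtain ⟨-, o1, -, -, o4⟩ := transversal h2 hB₂
  obtain ⟨-, o1', -, -, -⟩ := transversal h2 hB₁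
  obtain ⟨-, g1, -, -, -⟩ := transversal hB hB₁
  obtain ⟨Q', hQ1', hQ2'⟩ := exists_mem_par_par h1 o1 o4 B₂ A
  refine ⟨Q', hQ1', hQ2', ?_, hS2⟩
  obtain ⟨p1, p2, p3⟩ := 𝒜.par_mem h1 B₁
  obtain ⟨q1, q2, q3⟩ := 𝒜.par_mem h1 B₂
  have n1 : 𝒜.line O I ≠ 𝒜.par (𝒜.line O I) B₁ := fun e => hB₁ (e ▸ p2)
  have n2 : 𝒜.line O I ≠ 𝒜.par (𝒜.line O I) B₂ := fun e => hB₂ (e ▸ q2)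
  have n3 : 𝒜.par (𝒜.line O I) B₁ ≠ 𝒜.par (𝒜.line O I) B₂ := fun e => h12 (e ▸ q2)
  -- The triangles `B₁ O B₂` and `Q A Q'` give `QQ' ∥ B₁B₂`;
  -- then `B B₁ B₂` and `S Q Q'` give the claim.
  have k : Q' ∈ 𝒜.par (𝒜.line B₁ B₂) Q :=
    hD.mem_par_of_parallel p1 h1 q1 p3.symm q3 n1.symm n2 n3 p2 hQ1 h2 hA q2 hQ1'
      (by rw [line_comm]; exact mem_par_symm o1' hQ2) hQ2'
  have hB2 := (transversal (𝒜 := 𝒜) hB hB₂).2.1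
  exact mem_par_symm hB2 <| hD.mem_par_of_parallel h1 p1 q1 p3 (p3.symm.trans 𝒜 p1 h1 q1 q3)
    n1 n3 n2 hB hS2 p2 hQ1 q2 hQ1' (mem_par_symm g1 hS1) k

/-- If `OI` has a third point, then some point lies neither on `OI` nor on the parallel to `OI`
through `B₁`. -/
theorem exists_notMem_notMem_par {O I B₁ X : P} (h : O ≠ I) (hB₁ : B₁ ∉ 𝒜.line O I)
    (hX : X ∈ 𝒜.line O I) (hXO : X ≠ O) (hXI : X ≠ I) :
    ∃ Y, Y ∉ 𝒜.line O I ∧ Y ∉ 𝒜.par (𝒜.line O I) B₁ := by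
  obtain ⟨h1, h2, h3⟩ := 𝒜.line_mem h
  obtain ⟨-, o1, o2, o3, o4⟩ := transversal h2 hB₁
  obtain ⟨-, i1, i2, i3, i4⟩ := transversal h3 hB₁
  obtain ⟨p1, p2, p3⟩ := 𝒜.par_mem h1 B₁
  obtain ⟨Y, hY1, hY2⟩ := exists_mem_par_par i1 o1 (not_parallel_line_line h hB₁) X O
  rw [par_of_mem o1 o2] at hY2
  refine ⟨Y, fun hY => ?_, fun hY => ?_⟩
  · obtain rfl := eq_of_mem_of_mem h1 o1 (fun k => o4 (Or.inl k)) hY hY2 h2 o2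
    exact i4 (parallel_of_mem_par i1 h1 hXO hX hY hY1).symm
  · obtain rfl := eq_of_mem_of_mem p1 o1 (fun k => o4 (k ▸ p3)) hY hY2 p2 o3
    have := mem_par_symm i1 hY1
    rw [par_of_mem i1 i3] at this
    exact hXI (eq_of_mem_of_mem h1 i1 (fun k => i4 (Or.inl k)) hX this h3 i2)

theorem IsSum.change_aux (hD : 𝒜.Desargues) {O I B₁ B₂ A B S : P} (h : O ≠ I)
    (hB₁ : B₁ ∉ 𝒜.line O I) (hB₂ : B₂ ∉ 𝒜.line O I)
    (hA : A ∈ 𝒜.line O I) (hB : B ∈ 𝒜.line O I) (hS : 𝒜.IsSum O I B₁ A B S) :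
    𝒜.IsSum O I B₂ A B S := by
  obtain ⟨h1, h2, h3⟩ := 𝒜.line_mem h
  by_cases h12 : B₂ ∈ 𝒜.par (𝒜.line O I) B₁
  swap
  · exact hS.change_aux_of_notMem hD h hB₁ hB₂ h12 hA hB
  have third : ∀ X ∈ 𝒜.line O I, X ≠ O → X ≠ I → 𝒜.IsSum O I B₂ A B S := by
    intro X hX hXO hXI
    obtain ⟨Y, hY, hY'⟩ := exists_notMem_notMem_par h hB₁ hX hXO hXI
    refine (hS.change_aux_of_notMem hD h hB₁ hY hY' hA hB).change_aux_of_notMem hD h hY hB₂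
      (fun k => hY' ?_) hA hB
    have := mem_par_symm h1 k
    rwa [par_eq_of_mem h1 h12] at this
  obtain ⟨S', hS'⟩ := exists_isSum (A := A) h hB₂ hB
  by_cases hAO : A = O
  · subst hAO
    rw [hS'.eq_of_zero_left h hB₂ hB] at hS'
    rwa [hS.eq_of_zero_left h hB₁ hB]
  by_cases hBO : B = O
  · subst hBO
    rw [hS'.eq_of_zero_right h hB₂ hA] at hS'
    rwa [hS.eq_of_zero_right h hB₁ hA]
  by_cases hAI : A = I
  swap
  · exact third A hA hAO hAI
  by_cases hBI : B = I
  swap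
  · exact third B hB hBO hBI
  subst hAI hBI
  -- What remains is `I + I`, which is `O` unless the line has a third point.
  by_cases hSO : S = O
  swap
  · exact third S hS.choose_spec.2.2.2 hSO (hS.ne_of_one_one h hB₁)
  by_cases hSO' : S' = O
  · rw [hSO'] at hS'
    rwa [hSO]
  · exact third S' hS'.choose_spec.2.2.2 hSO' (hS'.ne_of_one_one h hB₂)

/-! ### Products with an arbitrary auxiliary point -/

/-- `S` is the product `A · B` on the line `OI`, constructed with the auxiliary point `B₁`; the
witness is the intermediate point of the construction. -/
def IsProd (𝒜 : AffinePlane P) (O I B₁ A B S : P) : Prop :=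
  ∃ Q, Q ∈ 𝒜.par (𝒜.line I B₁) A ∧ Q ∈ 𝒜.line O B₁ ∧
    S ∈ 𝒜.par (𝒜.line B B₁) Q ∧ S ∈ 𝒜.line O I

theorem isProd_mul {O I A B : P} (h : O ≠ I) (hB : B ∈ 𝒜.line O I) :
    𝒜.IsProd O I (𝒜.aux O I) A B (𝒜.mul O I A B) := by
  obtain ⟨h1, h2, h3⟩ := 𝒜.line_mem h
  have hB₁ := 𝒜.aux_notMem h
  obtain ⟨-, o1, -⟩ := transversal h2 hB₁
  obtain ⟨-, i1, -⟩ := transversal h3 hB₁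
  obtain ⟨-, g1, -, -, g4⟩ := transversal hB hB₁
  obtain ⟨q1, -, q3⟩ := 𝒜.par_mem i1 A
  have n : ¬ Parallel (𝒜.par (𝒜.line I (𝒜.aux O I)) A) (𝒜.line O (𝒜.aux O I)) :=
    fun e => not_parallel_line_line h hB₁ (q3.trans 𝒜 i1 q1 o1 e)
  obtain ⟨p1, -, p3⟩ := 𝒜.par_mem g1
    (𝒜.meet (𝒜.par (𝒜.line I (𝒜.aux O I)) A) (𝒜.line O (𝒜.aux O I)))
  exact ⟨_, (𝒜.meet_mem n).1, (𝒜.meet_mem n).2,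
    𝒜.meet_mem fun e => g4 (p3.trans 𝒜 g1 p1 h1 e).symm⟩

theorem IsProd.mul_eq {O I A B S : P} (h : O ≠ I) (hB : B ∈ 𝒜.line O I)
    (hS : 𝒜.IsProd O I (𝒜.aux O I) A B S) : 𝒜.mul O I A B = S := by
  obtain ⟨h1, h2, h3⟩ := 𝒜.line_mem h
  obtain ⟨Q, hQ1, hQ2, hS1, hS2⟩ := hS
  have hB₁ := 𝒜.aux_notMem h
  obtain ⟨-, o1, -⟩ := transversal h2 hB₁
  obtain ⟨-, i1, -⟩ := transversal h3 hB₁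
  obtain ⟨-, g1, -, -, g4⟩ := transversal hB hB₁
  obtain ⟨q1, -, q3⟩ := 𝒜.par_mem i1 A
  obtain ⟨p1, -, p3⟩ := 𝒜.par_mem g1 Q
  unfold mul
  dsimp only
  rw [𝒜.meet_eq q1 o1 (fun e => not_parallel_line_line h hB₁ (q3.trans 𝒜 i1 q1 o1 e)) hQ1 hQ2]
  exact 𝒜.meet_eq p1 h1 (fun e => g4 (p3.trans 𝒜 g1 p1 h1 e).symm) hS1 hS2

/-- The product does not depend on the auxiliary point if the two auxiliary points lie on different
lines through `O`. -/
theorem IsProd.change_aux_of_notMem (hD : 𝒜.Desargues) {O I B₁ B₂ A B S : P} (h : O ≠ I)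
    (hB₁ : B₁ ∉ 𝒜.line O I) (hB₂ : B₂ ∉ 𝒜.line O I) (h12 : B₂ ∉ 𝒜.line O B₁)
    (hA : A ∈ 𝒜.line O I) (hB : B ∈ 𝒜.line O I) (hS : 𝒜.IsProd O I B₁ A B S) :
    𝒜.IsProd O I B₂ A B S := by
  obtain ⟨h1, h2, h3⟩ := 𝒜.line_mem h
  obtain ⟨Q, hQ1, hQ2, hS1, hS2⟩ := hS
  obtain ⟨no, o1, o2, o3, o4⟩ := transversal h2 hB₁
  obtain ⟨no', o1', o2', o3', o4'⟩ := transversal h2 hB₂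
  obtain ⟨-, i1, -⟩ := transversal h3 hB₁
  obtain ⟨-, i1', -⟩ := transversal h3 hB₂
  obtain ⟨-, g1, -⟩ := transversal hB hB₁
  obtain ⟨-, g1', -⟩ := transversal hB hB₂
  obtain ⟨Q', hQ1', hQ2'⟩ := exists_mem_par_par i1' o1' (not_parallel_line_line h hB₂) A O
  rw [par_of_mem o1' o2'] at hQ2'
  refine ⟨Q', hQ1', hQ2', ?_, hS2⟩
  have n1 : 𝒜.line O I ≠ 𝒜.line O B₁ := fun e => o4 (Or.inl e)
  have n2 : 𝒜.line O I ≠ 𝒜.line O B₂ := fun e => o4' (Or.inl e)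
  have n3 : 𝒜.line O B₁ ≠ 𝒜.line O B₂ := fun e => h12 (e ▸ o3')
  -- The triangles `B₁ I B₂` and `Q A Q'` give `QQ' ∥ B₁B₂`;
  -- then `B B₁ B₂` and `S Q Q'` give the claim.
  have k : Q' ∈ 𝒜.par (𝒜.line B₁ B₂) Q :=
    hD.mem_par_of_center o1 h1 o1' o2 h2 o2' n1.symm n2 n3 o3 hQ2 h3 hA o3' hQ2' no.symm h.symm
      no'.symm (by rw [line_comm]; exact mem_par_symm i1 hQ1) hQ1'
  by_cases hBO : B = O
  · subst hBO
    rw [par_of_mem o1 hQ2] at hS1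
    obtain rfl := eq_of_mem_of_mem h1 o1 n1 hS2 hS1 h2 o2
    rwa [par_of_mem o1' hQ2']
  · exact mem_par_symm g1' <| hD.mem_par_of_center h1 o1 o1' h2 o2 o2' n1 n3 n2 hB hS2 o3 hQ2 o3'
      hQ2' hBO no.symm no'.symm (mem_par_symm g1 hS1) k

theorem IsProd.change_aux (hD : 𝒜.Desargues) {O I B₁ B₂ A B S : P} (h : O ≠ I)
    (hB₁ : B₁ ∉ 𝒜.line O I) (hB₂ : B₂ ∉ 𝒜.line O I)
    (hA : A ∈ 𝒜.line O I) (hB : B ∈ 𝒜.line O I) (hS : 𝒜.IsProd O I B₁ A B S) :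
    𝒜.IsProd O I B₂ A B S := by
  by_cases h12 : B₂ ∈ 𝒜.line O B₁
  swap
  · exact hS.change_aux_of_notMem hD h hB₁ hB₂ h12 hA hB
  obtain ⟨h1, h2, h3⟩ := 𝒜.line_mem h
  obtain ⟨-, o1, o2, o3, o4⟩ := transversal h2 hB₁
  -- The fourth vertex of the parallelogram on `O`, `I`, `B₁` lies on neither of the two lines.
  obtain ⟨Y, hY1, hY2⟩ := exists_mem_par_par h1 o1 o4 B₁ I
  have hY : Y ∉ 𝒜.line O I := fun k => notMem_par h1 hB₁ k hY1
  have hIo : I ∉ 𝒜.line O B₁ := fun k =>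
    h (eq_of_mem_of_mem h1 o1 (fun k => o4 (Or.inl k)) h2 o2 h3 k)
  have hYo : Y ∉ 𝒜.line O B₁ := fun k => notMem_par o1 hIo k hY2
  refine (hS.change_aux_of_notMem hD h hB₁ hY hYo hA hB).change_aux_of_notMem hD h hY hB₂
    (fun k => hYo ?_) hA hB
  obtain ⟨-, y1, y2, y3, -⟩ := transversal h2 hY
  have hne : O ≠ B₂ := fun e => hB₂ (e ▸ h2)
  rwa [← 𝒜.line_eq hne o1 o2 h12, 𝒜.line_eq hne y1 y2 k]

/-! ### Collineations -/

namespace IsCollineation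

variable {φ : Equiv.Perm P}

theorem apply_mem_line (hφ : 𝒜.IsCollineation φ)
    {p q x : P} (hx : x ∈ 𝒜.line p q) : φ x ∈ 𝒜.line (φ p) (φ q) := by
  obtain ⟨l, hl, h1, h2, h3⟩ := hx
  exact ⟨φ '' l, (hφ l).1 hl, ⟨p, h1, rfl⟩, ⟨q, h2, rfl⟩, ⟨x, h3, rfl⟩⟩

theorem image_line (hφ : 𝒜.IsCollineation φ)
    {p q : P} (h : p ≠ q) : φ '' 𝒜.line p q = 𝒜.line (φ p) (φ q) := by
  obtain ⟨h1, h2, h3⟩ := 𝒜.line_mem h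
  exact (𝒜.line_eq (φ.injective.ne h) ((hφ _).1 h1) ⟨p, h2, rfl⟩ ⟨q, h3, rfl⟩).symm

theorem apply_notMem_line (hφ : 𝒜.IsCollineation φ) {p q x : P} (h : p ≠ q) (hx : x ∉ 𝒜.line p q) :
    φ x ∉ 𝒜.line (φ p) (φ q) := by
  rwa [← hφ.image_line h, φ.injective.mem_set_image]

theorem apply_mem_par (hφ : 𝒜.IsCollineation φ)
    {p q r x : P} (h : p ≠ q) (hx : x ∈ 𝒜.par (𝒜.line p q) r) :
    φ x ∈ 𝒜.par (𝒜.line (φ p) (φ q)) (φ r) := by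
  obtain ⟨m, hm, h1, h2, h3⟩ := hx
  refine ⟨φ '' m, (hφ m).1 hm, ⟨r, h1, rfl⟩, ?_, ⟨x, h3, rfl⟩⟩
  rw [← hφ.image_line h]
  rcases h2 with h2 | h2
  · exact Or.inl (by rw [h2])
  · exact Or.inr (by rw [← Set.image_inter φ.injective, h2, Set.image_empty])

theorem map_add (hφ : 𝒜.IsCollineation φ) (hD : 𝒜.Desargues)
    {O I A B : P} (h : O ≠ I) (hA : A ∈ 𝒜.line O I) (hB : B ∈ 𝒜.line O I) :
    𝒜.add (φ O) (φ I) (φ A) (φ B) = φ (𝒜.add O I A B) := by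
  have h' : φ O ≠ φ I := φ.injective.ne h
  have hB₁ := 𝒜.aux_notMem h
  have key : 𝒜.IsSum (φ O) (φ I) (φ (𝒜.aux O I)) (φ A) (φ B) (φ (𝒜.add O I A B)) := by
    obtain ⟨Q, h1, h2, h3, h4⟩ := isSum_add (A := A) h hB
    exact ⟨φ Q, hφ.apply_mem_par h h1,
      hφ.apply_mem_par (transversal (𝒜 := 𝒜) (𝒜.line_mem h).2.1 hB₁).1 h2,
      hφ.apply_mem_par (transversal (𝒜 := 𝒜) hB hB₁).1 h3, hφ.apply_mem_line h4⟩
  exact (key.change_aux hD h' (hφ.apply_notMem_line h hB₁) (𝒜.aux_notMem h')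
    (hφ.apply_mem_line hA) (hφ.apply_mem_line hB)).add_eq h' (hφ.apply_mem_line hB)

theorem map_mul (hφ : 𝒜.IsCollineation φ) (hD : 𝒜.Desargues)
    {O I A B : P} (h : O ≠ I) (hA : A ∈ 𝒜.line O I) (hB : B ∈ 𝒜.line O I) :
    𝒜.mul (φ O) (φ I) (φ A) (φ B) = φ (𝒜.mul O I A B) := by
  have h' : φ O ≠ φ I := φ.injective.ne h
  have hB₁ := 𝒜.aux_notMem h
  have key : 𝒜.IsProd (φ O) (φ I) (φ (𝒜.aux O I)) (φ A) (φ B) (φ (𝒜.mul O I A B)) := by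
    obtain ⟨Q, h1, h2, h3, h4⟩ := isProd_mul (A := A) h hB
    exact ⟨φ Q, hφ.apply_mem_par (transversal (𝒜 := 𝒜) (𝒜.line_mem h).2.2 hB₁).1 h1,
      hφ.apply_mem_line h2,
      hφ.apply_mem_par (transversal (𝒜 := 𝒜) hB hB₁).1 h3, hφ.apply_mem_line h4⟩
  exact (key.change_aux hD h' (hφ.apply_notMem_line h hB₁) (𝒜.aux_notMem h')
    (hφ.apply_mem_line hA) (hφ.apply_mem_line hB)).mul_eq h' (hφ.apply_mem_line hB)

theorem map_sub (hφ : 𝒜.IsCollineation φ) (hD : 𝒜.Desargues)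
    {O I A C : P} (h : O ≠ I) (hA : A ∈ 𝒜.line O I) (hC : C ∈ 𝒜.line O I) :
    𝒜.sub (φ O) (φ I) (φ A) (φ C) = φ (𝒜.sub O I A C) := by
  have h' : φ O ≠ φ I := φ.injective.ne h
  obtain ⟨n1, n2⟩ := 𝒜.neg_spec C h
  have e : 𝒜.neg (φ O) (φ I) (φ C) = φ (𝒜.neg O I C) :=
    (𝒜.existsUnique_add_eq h' (𝒜.line_mem h').2.1).unique (𝒜.neg_spec (φ C) h')
      ⟨hφ.apply_mem_line n1, by rw [hφ.map_add hD h hC n1, n2]⟩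
  rw [sub, e, hφ.map_add hD h hA n1, sub]

theorem map_ratio (hφ : 𝒜.IsCollineation φ) (hD : 𝒜.Desargues)
    {O I A B C : P} (h : O ≠ I) (hA : A ∈ 𝒜.line O I)
    (hB : B ∈ 𝒜.line O I) (hC : C ∈ 𝒜.line O I) (hBC : B ≠ C) :
    𝒜.ratio (φ O) (φ I) (φ A) (φ B) (φ C) = φ (𝒜.ratio O I A B C) := by
  have h' : φ O ≠ φ I := φ.injective.ne h
  have hB' := hφ.apply_mem_line hB
  have hC' := hφ.apply_mem_line hC
  have hBC' : φ B ≠ φ C := φ.injective.ne hBC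
  obtain ⟨r1, r2⟩ := 𝒜.ratio_spec (A := A) h hB hC hBC
  refine (𝒜.existsUnique_ratio h' hB' hC' hBC').unique (𝒜.ratio_spec h' hB' hC' hBC')
    ⟨hφ.apply_mem_line r1, ?_⟩
  rw [hφ.map_sub hD h hB hC, hφ.map_mul hD h (𝒜.sub_mem h) r1, r2, hφ.map_sub hD h hA hC]

end IsCollineation

end AffinePlane

/-- A translation `φ` of a Desargues affine plane maps the ratio `r(A, B; C)` on the line `OI` to the
ratio `r(φ A, φ B; φ C)` on the image line, whose zero and unit are `φ O` and `φ I`. -/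
theorem mainTheorem3 {P : Type*} (𝒜 : AffinePlane P) (hD : 𝒜.Desargues)
    (φ : Equiv.Perm P) (hφ : 𝒜.IsTranslation φ)
    (O I : P) (hOI : O ≠ I)
    (A B C : P) (hA : A ∈ 𝒜.line O I) (hB : B ∈ 𝒜.line O I) (hC : C ∈ 𝒜.line O I)
    (hBC : B ≠ C) :
    φ (𝒜.ratio O I A B C) = 𝒜.ratio (φ O) (φ I) (φ A) (φ B) (φ C) :=
  (hφ.1.1.map_ratio hD hOI hA hB hC hBC).symm
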